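/- Let $G$ be a finite simple undirected graph with $n$ nodes and adjacency matrix $A\in\{0,1\}^{n\times n}$. Let $\mathbf 1$ be the all-ones column vector of size $n$, $I$ the identity matrix, $J=\mathbf 1\mathbf 1^{\top}-I$, and let $\odot$ denote the entrywise product, $\operatorname{diag}(v)$ the diagonal matrix with diagonal $v$, and $(A^2>0)$ the $0$-$1$ matrix marking the positive entries of $A^2$. Put \begin{align*} X_2 &= A^2\odot J,\\ X_3 &= (A^3\odot J) - A(A^2\odot I) - (A^2\odot I)A + A,\\ X_4 &= (A^4\odot J) - \bigl(A(A^2\odot I-2I)A\bigr)\odot J - (A^2\odot I)X_2 - X_2(A^2\odot I)\\ &\quad - A(A^3\odot I) - (A^3\odot I)A + 3(A^2\odot A),\\ X_5 &= (A^5\odot J) - A(A^2\odot I)(A^2\odot I-I) - (A^2\odot I)A(A^2\odot I) - (A^2\odot I-I)(A^2\odot I)A\\ &\quad - \bigl(A(A^2\odot I-I)X_2\bigr)\odot J - \bigl(X_2(A^2\odot I-I)A\bigr)\odot J\\ &\quad - (A^2\odot I)X_3 - X_3(A^2\odot I-I) - (A^3\odot I)X_2 - X_2(A^3\odot I)\\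 &\quad - \bigl(A(A^3\odot I)A\bigr)\odot J - (A\odot A^2) + 3\bigl((A(A\odot A^2)+(A\odot A^2)A)\odot J\bigr)\\ &\quad - A\operatorname{diag}\bigl((A\odot X_3)\mathbf 1\bigr) - \operatorname{diag}\bigl((A\odot X_3)\mathbf 1\bigr)A\\ &\quad + 3(A\odot X_3) + 3\bigl(A\odot A^2\odot(A^2-(A^2>0))\bigr), \end{align*} and $C_l = A\odot X_{l-1}$ for $3\le l\le 6$. Theorem (cycle counting at graph level). For $3\le l\le 6$, the sentence $$\frac1{2l}\,\mathbf 1^{\top} C_l\,\mathbf 1$$ of the matrix language MATLANG (expressions built from one square matrix variable by sums, matrix products, entrywise products, transposes, traces, all-ones vectors, diagonal matrices of vectors, multiplication by real numbers and entrywise application of scalar functions, with a scalar value), evaluated at the adjacency matrix $A$, equals the number of $l$-cycles of $G$, that is, the number of subgraphs of $G$ isomorphic to the cycle graph on $l$ vertices. -/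

import Mathlib

namespace Matlang

/-- The two possible side lengths of a matrix produced by MATLANG from one square matrix:
`one` (length `1`) and `node` (the number of nodes). -/
inductive Dim : Type
  | one : Dim
  | node : Dim

/-- The index set belonging to a side length, when the nodes are the elements of `V`. -/
@[reducible] def Dim.Idx (V : Type*) : Dim → Type _
  | Dim.one => PUnit
  | Dim.node => V

instance (V : Type*) [Fintype V] : (d : Dim) → Fintype (d.Idx V)
  | Dim.one => inferInstanceAs (Fintype PUnit)
  | Dim.node => inferInstanceAs (Fintype V)

instance (V : Type*) [DecidableEq V] : (d : Dim) → DecidableEq (d.Idx V)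
  | Dim.one => inferInstanceAs (DecidableEq PUnit)
  | Dim.node => inferInstanceAs (DecidableEq V)

/-- The expressions (words) of the matrix language MATLANG over one square matrix variable.
`Word a b` holds the words whose values have row side `a` and column side `b`: square matrices
(`Word node node`), column vectors (`Word node one`), row vectors (`Word one node`) and scalars
(`Word one one`). -/
inductive Word : Dim → Dim → Type
  /-- the given square matrix -/
  | var : Word Dim.node Dim.node
  /-- sum -/
  | add {a b : Dim} : Word a b → Word a b → Word a b
  /-- usual matrix product -/
  | mul {a b c : Dim} : Word a b → Word b c → Word a c
  /-- element-wise (Hadamard) product -/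
  | had {a b : Dim} : Word a b → Word a b → Word a b
  /-- transpose -/
  | tr {a b : Dim} : Word a b → Word b a
  /-- trace, a scalar -/
  | trace {a : Dim} : Word a a → Word Dim.one Dim.one
  /-- diagonal matrix with the entries of a given column vector -/
  | diag {a : Dim} : Word a Dim.one → Word a a
  /-- column vector of ones, with as many entries as the argument has rows -/
  | ones {a b : Dim} : Word a b → Word a Dim.one
  /-- multiplication by a real number -/
  | smul {a b : Dim} : ℝ → Word a b → Word a b
  /-- element-wise application of a function -/
  | map {a b : Dim} : (ℝ → ℝ) → Word a b → Word a b

/-- A sentence is a word with a scalar value. -/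
abbrev Sentence : Type := Word Dim.one Dim.one

/-- The value of a word on a given square matrix. -/
noncomputable def Word.eval {V : Type*} [Fintype V] [DecidableEq V] (M : Matrix V V ℝ) :
    {a b : Dim} → Word a b → Matrix (a.Idx V) (b.Idx V) ℝ
  | _, _, .var => M
  | _, _, .add e f => e.eval M + f.eval M
  | _, _, .mul e f => e.eval M * f.eval M
  | _, _, .had e f => Matrix.hadamard (e.eval M) (f.eval M)
  | _, _, .tr e => (e.eval M).transpose
  | _, _, .trace e => Matrix.of fun _ _ => (e.eval M).trace
  | _, _, .diag e => Matrix.diagonal fun i => e.eval M i PUnit.unit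
  | _, _, .ones _ => Matrix.of fun _ _ => 1
  | _, _, .smul c e => c • e.eval M
  | _, _, .map f e => (e.eval M).map f

/-- The real number that a sentence computes from a square matrix. -/
noncomputable def Sentence.value {V : Type*} [Fintype V] [DecidableEq V] (s : Sentence)
    (M : Matrix V V ℝ) : ℝ :=
  Word.eval M s PUnit.unit PUnit.unit

section Formulas

noncomputable instance {a b : Dim} : Add (Word a b) := ⟨Word.add⟩
noncomputable instance {a b : Dim} : Sub (Word a b) := ⟨fun e f => e.add (f.smul (-1))⟩
noncomputable instance {a b c : Dim} : HMul (Word a b) (Word b c) (Word a c) := ⟨Word.mul⟩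
noncomputable instance {a b : Dim} : SMul ℝ (Word a b) := ⟨Word.smul⟩

local infixl:72 " ⊙ " => Word.had

/-- The variable, to be interpreted by the adjacency matrix. -/
def A : Word Dim.node Dim.node := .var

/-- The all-ones column vector with one entry per node. -/
def one : Word Dim.node Dim.one := .ones A

/-- The identity matrix. -/
def Id : Word Dim.node Dim.node := .diag one

/-- The matrix with zeros on the diagonal and ones elsewhere. -/
noncomputable def J : Word Dim.node Dim.node := one * one.tr - Id

noncomputable def A2 : Word Dim.node Dim.node := A * A
noncomputable def A3 : Word Dim.node Dim.node := A2 * A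
noncomputable def A4 : Word Dim.node Dim.node := A3 * A
noncomputable def A5 : Word Dim.node Dim.node := A4 * A

/-- The diagonal part of the square of the adjacency matrix. -/
noncomputable def D2 : Word Dim.node Dim.node := A2 ⊙ Id

/-- The diagonal part of the cube of the adjacency matrix. -/
noncomputable def D3 : Word Dim.node Dim.node := A3 ⊙ Id

/-- The 0-1 matrix that marks the positive entries of the square of the adjacency matrix. -/
noncomputable def A2pos : Word Dim.node Dim.node := A2.map fun x => if 0 < x then 1 else 0

noncomputable def X2 : Word Dim.node Dim.node := A2 ⊙ J

noncomputable def X3 : Word Dim.node Dim.node := A3 ⊙ J - A * D2 - D2 * A + A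

noncomputable def X4 : Word Dim.node Dim.node :=
  A4 ⊙ J - (A * (D2 - (2 : ℝ) • Id) * A) ⊙ J
    - D2 * X2 - X2 * D2
    - A * D3 - D3 * A + (3 : ℝ) • (A2 ⊙ A)

noncomputable def X5 : Word Dim.node Dim.node :=
  A5 ⊙ J - A * D2 * (D2 - Id)
    - D2 * A * D2 - (D2 - Id) * D2 * A
    - (A * (D2 - Id) * X2) ⊙ J
    - (X2 * (D2 - Id) * A) ⊙ J
    - D2 * X3 - X3 * (D2 - Id)
    - D3 * X2 - X2 * D3
    - (A * D3 * A) ⊙ J - A ⊙ A2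
    + (3 : ℝ) • ((A * (A ⊙ A2) + (A ⊙ A2) * A) ⊙ J)
    - A * Word.diag ((A ⊙ X3) * one) - Word.diag ((A ⊙ X3) * one) * A
    + (3 : ℝ) • (A ⊙ X3) + (3 : ℝ) • (A ⊙ A2 ⊙ (A2 - A2pos))

/-- The matrix word `X_l` (path counting), for `2 ≤ l ≤ 5`; for the other `l`, where there is no
such word, the value is a placeholder. -/
noncomputable def X : ℕ → Word Dim.node Dim.node
  | 2 => X2
  | 3 => X3
  | 4 => X4
  | 5 => X5
  | _ => (0 : ℝ) • A

/-- The matrix word `C_l = A ⊙ X_{l-1}` (cycle counting at edge level), for `3 ≤ l ≤ 6`. -/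
noncomputable def C (l : ℕ) : Word Dim.node Dim.node := A ⊙ X (l - 1)

/-- The sentence `(1 / (2l)) 1ᵀ C_l 1`. -/
noncomputable def cycleSentence (l : ℕ) : Sentence :=
  (1 / (2 * (l : ℝ))) • (one.tr * C l * one)

end Formulas

end Matlang

/-! Each cycle on `l` vertices arises from exactly `2l` injective closed vertex sequences, because
the cycle graph has `2l` automorphisms (`card_cycleGraph_iso`) and labelled copies are copies times
automorphisms. So it suffices that the entries of `C_l` sum to the number of such sequences. Cutting
a sequence at the edge between its first and last vertices leaves a path with `l - 1` edges between
adjacent vertices `i`, `j`.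

Hence only the entries of `X_{l-1}` at adjacent pairs matter, and there they must count paths. A
path is a walk whose non-consecutive vertices differ; consecutive ones differ because the diagonal
vanishes. Writing each such condition as a factor `neInd` and summing out one vertex at a time is
inclusion–exclusion, and idempotence of the entries reduces all corrections to walk counts and
degrees (`sum_paths_three`, `sum_paths_four`, `sum_paths_five`). The lemmas `eval_X3_apply`,
`eval_X4_apply` and `eval_X5_apply` bring the words to the same normal forms; for `X2` every walk is
already a path. -/

namespace SimpleGraph

/-! ### Labelled copies and automorphisms of the cycle graph -/

/-- Labelled copies of `H` in `G` correspond to pairs of a subgraph isomorphic to `H` and an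
automorphism of `H`. -/
theorem labelledCopyCount_eq_copyCount_mul_card_iso {V W : Type*} [Fintype V] [Fintype W]
    (G : SimpleGraph V) (H : SimpleGraph W) :
    G.labelledCopyCount H = G.copyCount H * Nat.card (H ≃g H) := by
  classical
  let S := {G' : G.Subgraph // Nonempty (H ≃g G'.coe)}
  -- With one isomorphism chosen per subgraph, every copy is an automorphism, then the chosen
  -- isomorphism onto its image, then the inclusion.
  let F : S × (H ≃g H) → H.Copy G := fun p =>
    p.1.1.coeCopy.comp (Iso.toCopy (p.2.trans p.1.2.some))
  have hF : ∀ p, (F p).toSubgraph = p.1.1 := by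
    rintro ⟨⟨G', h⟩, σ⟩
    change Subgraph.map (G'.hom.comp (Iso.toHom (σ.trans h.some))) ⊤ = G'
    rw [Subgraph.map_comp]
    simp
  have hbij : Function.Bijective F := by
    constructor
    · rintro ⟨⟨G₁, h₁⟩, σ⟩ ⟨⟨G₂, h₂⟩, τ⟩ h
      obtain rfl : G₁ = G₂ := by
        have := congrArg Copy.toSubgraph h
        rwa [hF, hF] at this
      refine Prod.ext rfl (RelIso.ext fun a => ?_)
      have := DFunLike.congr_fun h a
      exact h₁.some.injective (Subtype.ext this)
    · intro ψ
      have h : Nonempty (H ≃g ψ.toSubgraph.coe) := ⟨ψ.isoToSubgraph⟩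
      refine ⟨⟨⟨ψ.toSubgraph, h⟩, ψ.isoToSubgraph.trans h.some.symm⟩, ?_⟩
      ext a
      change ((h.some (h.some.symm (ψ.isoToSubgraph a)) : ψ.toSubgraph.verts) : V) = ψ a
      rw [RelIso.apply_symm_apply]
      rfl
  rw [labelledCopyCount, copyCount, ← Nat.card_eq_fintype_card, ← Nat.card_eq_of_bijective F hbij,
    Nat.card_prod, Nat.card_eq_fintype_card, Fintype.card_subtype]

-- Going round the cycle, `σ (k + 2)` is a neighbour of `σ (k + 1)`; injectivity forbids turning
-- back to `σ k` because `2 ≠ 0` modulo `n + 3`. So the initial step `+1` persists.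
open Fin.CommRing in
theorem cycleGraph_iso_apply_of_sub_eq_one {n : ℕ} (σ : cycleGraph (n + 3) ≃g cycleGraph (n + 3))
    (h : σ 1 - σ 0 = 1) (k : Fin (n + 3)) : σ k = σ 0 + k := by
  have key : ∀ k : ℕ, σ ((k : Fin (n + 3)) + 1) = σ k + 1 := by
    intro k
    induction k with
    | zero => simpa [sub_eq_iff_eq_add'] using h
    | succ k ih =>
      have hadj : (cycleGraph (n + 3)).Adj (σ ((k : Fin (n + 3)) + 1 + 1)) (σ ((k : Fin (n + 3)) + 1)) :=
        σ.map_adj_iff.2 (by simp [cycleGraph_adj])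
      push_cast
      rcases cycleGraph_adj.1 hadj with h1 | h1
      · exact sub_eq_iff_eq_add'.1 h1
      · exfalso
        have h2 : σ ((k : Fin (n + 3)) + 1 + 1) = σ k := by
          rw [ih] at h1
          linear_combination -h1
        have h3 := σ.injective h2
        have h4 : (1 + 1 : Fin (n + 3)) = 0 := by linear_combination h3
        simp [Fin.ext_iff, Fin.val_add, Nat.mod_eq_of_lt (show 2 < n + 3 by lia)] at h4
  have : ∀ k : ℕ, σ (k : Fin (n + 3)) = σ 0 + k := by
    intro k
    induction k with
    | zero => simp
    | succ k ih => push_cast; rw [key, ih]; ring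
  simpa using this k.val

open Fin.CommRing in
/-- The cycle graph on `n ≥ 3` vertices has `2n` automorphisms. -/
theorem card_cycleGraph_iso (n : ℕ) :
    Nat.card (cycleGraph (n + 3) ≃g cycleGraph (n + 3)) = 2 * (n + 3) := by
  let rot : Fin (n + 3) → (cycleGraph (n + 3) ≃g cycleGraph (n + 3)) := fun a =>
    ⟨Equiv.addLeft a, by simp [cycleGraph_adj]⟩
  let refl : Fin (n + 3) → (cycleGraph (n + 3) ≃g cycleGraph (n + 3)) := fun a =>
    ⟨Equiv.subLeft a, by simp [cycleGraph_adj, or_comm]⟩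
  have hrot : ∀ a k, rot a k = a + k := fun _ _ => rfl
  have hrefl : ∀ a k, refl a k = a - k := fun _ _ => rfl
  let F : Fin (n + 3) ⊕ Fin (n + 3) → (cycleGraph (n + 3) ≃g cycleGraph (n + 3)) :=
    Sum.elim rot refl
  -- This separates rotations from reflections; it would fail modulo `2`.
  have h2 : (1 + 1 : Fin (n + 3)) ≠ 0 := by
    simp [Fin.ext_iff, Fin.val_add, Nat.mod_eq_of_lt (show 2 < n + 3 by lia)]
  have hbij : Function.Bijective F := by
    constructor
    · rintro (a | a) (b | b) h <;>
        have h0 := DFunLike.congr_fun h 0 <;> have h1 := DFunLike.congr_fun h 1 <;>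
        simp only [F, Sum.elim_inl, Sum.elim_inr, hrot, hrefl, add_zero, sub_zero] at h0 h1
      · rw [h0]
      · exact absurd (by linear_combination h1 - h0) h2
      · exact absurd (by linear_combination h0 - h1) h2
      · rw [h0]
    · intro σ
      have hadj : (cycleGraph (n + 3)).Adj (σ 1) (σ 0) :=
        σ.map_adj_iff.2 (by simp [cycleGraph_adj])
      rcases cycleGraph_adj.1 hadj with h | h
      · exact ⟨Sum.inl (σ 0), RelIso.ext fun k => (cycleGraph_iso_apply_of_sub_eq_one σ h k).symm⟩
      · refine ⟨Sum.inr (σ 0), RelIso.ext fun k => ?_⟩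
        -- The initial step is `-1` here; composing with negation makes it `+1`.
        have := cycleGraph_iso_apply_of_sub_eq_one (σ.trans (refl 0))
          (by simp only [RelIso.trans_apply, hrefl]; linear_combination h) k
        simp only [RelIso.trans_apply, hrefl] at this
        change refl (σ 0) k = σ k
        rw [hrefl]
        linear_combination this
  rw [← Nat.card_eq_of_bijective F hbij]
  simp [two_mul]

/-- Labelled copies of a graph, counted as injective adjacency-preserving functions. -/
theorem labelledCopyCount_eq_card {V W : Type*} [Fintype V] [Fintype W]
    (G : SimpleGraph V) (H : SimpleGraph W) :
    G.labelledCopyCount H = Nat.card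
      {f : W → V // (∀ a b, H.Adj a b → G.Adj (f a) (f b)) ∧ Function.Injective f} := by
  classical
  rw [labelledCopyCount, ← Nat.card_eq_fintype_card]
  exact Nat.card_congr
    { toFun := fun f => ⟨f, fun _ _ h => f.toHom.map_adj h, f.injective⟩
      invFun := fun f => ⟨⟨f.1, fun h => f.2.1 _ _ h⟩, f.2.2⟩
      left_inv := fun _ => rfl
      right_inv := fun _ => rfl }

theorem cycleGraph_hom_iff {V : Type*} (G : SimpleGraph V) {n : ℕ} (f : Fin (n + 2) → V) :
    (∀ a b, (cycleGraph (n + 2)).Adj a b → G.Adj (f a) (f b)) ↔ ∀ a, G.Adj (f a) (f (a + 1)) := by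
  constructor
  · intro h a
    exact h _ _ (by simp [cycleGraph_adj])
  · intro h a b hab
    rcases cycleGraph_adj.1 hab with hab | hab
    · obtain rfl := sub_eq_iff_eq_add'.1 hab
      exact (h b).symm
    · obtain rfl := sub_eq_iff_eq_add'.1 hab
      exact h a

/-- Twice the length times the number of cycles of that length is the number of injective
closed vertex sequences. -/
theorem two_mul_mul_copyCount_cycleGraph {V : Type*} [Fintype V] [DecidableEq V]
    (G : SimpleGraph V) [DecidableRel G.Adj] (n : ℕ) :
    2 * (n + 3) * (G.copyCount (cycleGraph (n + 3)) : ℝ) =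
      ∑ f : Fin (n + 3) → V,
        if (∀ a, G.Adj (f a) (f (a + 1))) ∧ Function.Injective f then (1 : ℝ) else 0 := by
  have h := G.labelledCopyCount_eq_copyCount_mul_card_iso (cycleGraph (n + 3))
  rw [card_cycleGraph_iso, labelledCopyCount_eq_card,
    Nat.card_congr (Equiv.subtypeEquivRight fun f =>
      and_congr_left' (cycleGraph_hom_iff G (n := n + 1) f)),
    Nat.card_eq_fintype_card, Fintype.card_subtype] at h
  rw [Finset.sum_boole, h]
  push_cast
  ring

end SimpleGraph

/-! ### Paths between adjacent vertices by inclusion–exclusion -/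

open Finset Matrix

/-- The indicator of distinctness. -/
noncomputable def neInd {V : Type*} [DecidableEq V] (x y : V) : ℝ := if x = y then 0 else 1

section
variable {V : Type*} [Fintype V] [DecidableEq V]

theorem sum_mul_neInd (f : V → ℝ) (y : V) : ∑ x, f x * neInd x y = ∑ x, f x - f y := by
  have : ∀ x, f x * neInd x y = f x - if x = y then f x else 0 := by
    intro x; unfold neInd; split_ifs <;> simp
  simp [this]

theorem sum_mul_neInd' (f : V → ℝ) (y : V) : ∑ x, f x * neInd y x = ∑ x, f x - f y := by
  rw [← sum_mul_neInd]
  simp only [neInd, eq_comm]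

theorem sum_mul_neInd_neInd (f : V → ℝ) {y z : V} (h : y ≠ z) :
    ∑ x, f x * neInd y x * neInd x z = ∑ x, f x - f y - f z := by
  rw [sum_mul_neInd, sum_mul_neInd']
  simp only [neInd, if_neg h, mul_one]

/-- A real matrix that is the adjacency matrix of a simple graph. -/
structure IsSimpleAdj (M : Matrix V V ℝ) : Prop where
  symm : ∀ x y, M x y = M y x
  diag : ∀ x, M x x = 0
  sq : ∀ x y, M x y * M x y = M x y

namespace IsSimpleAdj
variable {M : Matrix V V ℝ} (hM : IsSimpleAdj M)
include hM

omit [Fintype V] in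
theorem mul_neInd (x y : V) : M x y * neInd x y = M x y := by
  unfold neInd
  split_ifs with h
  · rw [h, hM.diag, zero_mul]
  · rw [mul_one]

omit [DecidableEq V] in
theorem sum_sq (x : V) : ∑ z, M x z = (M * M) x x := by
  rw [mul_apply]
  exact sum_congr rfl fun z _ => by rw [hM.symm z x, hM.sq]

omit [DecidableEq V] in
theorem mul_self_symm (x y : V) : (M * M) x y = (M * M) y x := by
  rw [mul_apply, mul_apply]
  exact sum_congr rfl fun z _ => by rw [hM.symm z y, hM.symm x z, mul_comm]

/-- For walks `i, a, b, j` the failures `b = i` and `a = j` are counted by the degrees of `i` and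
`j`; the final `1` restores `i, j, i, j`, removed twice. -/
theorem sum_paths_three {i j : V} (hij : M i j = 1) :
    ∑ b, ∑ a, M i a * M a b * M b j * (neInd i b * neInd a j) =
      (M * M * M) i j - (M * M) i i - (M * M) j j + 1 := by
  have h1 : ∀ b, ∑ a, M i a * M a b * M b j * (neInd i b * neInd a j) =
      (M b j * (M * M) i b - M b j * M j b) * neInd i b := by
    intro b
    rw [mul_apply]
    have := sum_mul_neInd (fun a => M i a * M a b * M b j * neInd i b) j
    simp only [hij] at this
    rw [sum_congr rfl fun a _ => show _ = M i a * M a b * M b j * neInd i b * neInd a j by ring,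
      this, mul_sum, sub_mul, sum_mul]
    rw [sum_congr rfl fun a _ => show _ = M b j * (M i a * M a b) * neInd i b by ring]
    ring
  rw [sum_congr rfl fun b _ => h1 b, sum_mul_neInd', sum_sub_distrib, hij, hM.symm j i, hij]
  have h2 : ∑ b, M b j * (M * M) i b = (M * M * M) i j := by
    rw [mul_apply]; exact sum_congr rfl fun b _ => mul_comm _ _
  have h3 : ∑ b, M b j * M j b = (M * M) j j := by
    rw [mul_apply]; exact sum_congr rfl fun b _ => mul_comm _ _
  rw [h2, h3]; ring

/-- With the middle vertex `b` of `i, a, b, c, j` fixed, `a` and `c` interact only through `a ≠ c`.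
So the sum over them is a product minus the term `a = c`; the values `b = i` and `b = j` are then
removed. -/
theorem sum_paths_four {i j : V} (hne : i ≠ j) (hij : M i j = 1) :
    ∑ b, ∑ a, ∑ c, M i a * M a b * M b c * M c j *
        (neInd i b * neInd i c * neInd a c * neInd a j * neInd b j) =
      (M * M * M * M) i j - ∑ k, M i k * (M * M) k k * M k j + 5 * (M * M) i j
        - ((M * M) i i + (M * M) j j) * (M * M) i j - (M * M * M) i i - (M * M * M) j j := by
  have hji : M j i = 1 := hM.symm j i ▸ hij
  have inner : ∀ b, ∑ a, ∑ c, M i a * M a b * M b c * M c j *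
        (neInd i b * neInd i c * neInd a c * neInd a j * neInd b j) =
      (((M * M) i b - M j b) * ((M * M) b j - M b i) - ∑ a, M i a * M a b * M a j)
        * neInd i b * neInd b j := by
    intro b
    have e1 : ∀ a, ∑ c, M i a * M a b * M b c * M c j *
        (neInd i b * neInd i c * neInd a c * neInd a j * neInd b j) =
        ((M i a * M a b * neInd a j) * ((M * M) b j - M b i) - M i a * M a b * M a j)
        * neInd i b * neInd b j := by
      intro a
      have := (sum_mul_neInd' (fun c => M b c * M c j * neInd i c) a).trans
        (congrArg (· - M b a * M a j * neInd i a) (sum_mul_neInd' (fun c => M b c * M c j) i))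
      rw [← mul_apply, hij] at this
      calc _ = (M i a * M a b * neInd a j * neInd i b * neInd b j) *
            ∑ c, M b c * M c j * neInd i c * neInd a c := by
            rw [mul_sum]; exact sum_congr rfl fun c _ => by ring
        _ = _ := by
            rw [this]
            have k1 := hM.mul_neInd i a
            have k2 := hM.mul_neInd a j
            have k3 := hM.sq a b
            have k4 := hM.symm b a
            rw [k4]
            linear_combination (-neInd i b * neInd b j * M a b * M a b * M a j * neInd a j) * k1 +
              (-neInd i b * neInd b j * M a b * M a b * M i a) * k2 +
              (-neInd i b * neInd b j * M a j * M i a) * k3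
    rw [sum_congr rfl fun a _ => e1 a, ← sum_mul, ← sum_mul, sum_sub_distrib, ← sum_mul,
      sum_mul_neInd, ← mul_apply, hij, one_mul]
  rw [sum_congr rfl fun b _ => inner b, sum_mul_neInd_neInd _ hne, sum_sub_distrib]
  have s1 : ∑ b, ((M * M) i b - M j b) * ((M * M) b j - M b i) =
      (M * M * M * M) i j - (M * M * M) i i - (M * M * M) j j + (M * M) j i := by
    rw [Matrix.mul_assoc (M * M) M M, mul_apply (N := M * M), mul_apply (M := M * M) (N := M) (i := i),
      Matrix.mul_assoc M M M, mul_apply (M := M) (N := M * M), mul_apply (M := M) (N := M) (i := j) (k := i),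
      ← sum_sub_distrib, ← sum_sub_distrib, ← sum_add_distrib]
    exact sum_congr rfl fun b _ => by ring
  have s2 : ∑ b, ∑ a, M i a * M a b * M a j = ∑ k, M i k * (M * M) k k * M k j := by
    rw [sum_comm]
    refine sum_congr rfl fun a _ => ?_
    rw [← hM.sum_sq, mul_sum, sum_mul]
  have s3 : ∑ a, M i a * M a i * M a j = (M * M) i j := by
    rw [mul_apply]
    exact sum_congr rfl fun a _ => by rw [hM.symm a i, hM.sq]
  have s4 : ∑ a, M i a * M a j * M a j = (M * M) i j := by
    rw [mul_apply]
    exact sum_congr rfl fun a _ => by rw [mul_assoc, hM.sq]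
  -- The coefficient `5` collects one from `s1` and two from each of the removed terms `b = i`, `b =
  -- j`.
  rw [s1, s2, s3, s4, hM.diag, hM.diag, hji, hM.mul_self_symm j i]
  ring

end IsSimpleAdj
end

section
variable {V : Type*} [Fintype V] [DecidableEq V]

omit [Fintype V] in
theorem neInd_mul_self (x y : V) : neInd x y * neInd x y = neInd x y := by
  unfold neInd; split_ifs <;> simp

/-- The excluded points may coincide; the indicators on the right prevent subtracting a point twice.
-/
theorem sum_mul_neInd'' (f : V → ℝ) (y z w : V) :
    ∑ x, f x * neInd y x * neInd z x * neInd w x =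
      ∑ x, f x - f y - f z * neInd y z - f w * neInd y w * neInd z w := by
  rw [sum_mul_neInd', sum_mul_neInd', sum_mul_neInd']

namespace IsSimpleAdj
variable {M : Matrix V V ℝ} (hM : IsSimpleAdj M)
include hM

/-- With the middle edge `b c` of `i, a, b, c, d, j` fixed, the first factor counts `a` outside `{j,
c}`, the second counts `d` outside `{i, b}`, and the sum over `a` removes `a = d`. -/
theorem sum_paths_five_inner {i j : V} (hij : M i j = 1) (b c : V) :
    ∑ a, ∑ d, M i a * M a b * M b c * M c d * M d j *
        (neInd i b * neInd i c * neInd i d * neInd a c * neInd a d * neInd a j *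
          neInd b d * neInd b j * neInd c j) =
      M b c * (((M * M) i b - M j b - M i c * M b c) * ((M * M) c j - M i c - M b c * M b j)
        - ∑ a, M i a * M j a * M a b * M a c)
        * neInd i b * neInd b j * neInd i c * neInd c j := by
  -- `K` gathers the conditions free of `a` and `d`, and absorbs further copies of its indicators.
  set K : ℝ := M b c * neInd i b * neInd b j * neInd i c * neInd c j with hK
  have hKc : K * neInd c j = K := by rw [hK]; linear_combination (M b c * neInd i b * neInd b j * neInd i c) * neInd_mul_self c j
  have hKb : K * neInd i b = K := by rw [hK]; linear_combination (M b c * neInd c j * neInd b j * neInd i c) * neInd_mul_self i b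
  have e1 : ∀ a, ∑ d, M i a * M a b * M b c * M c d * M d j *
        (neInd i b * neInd i c * neInd i d * neInd a c * neInd a d * neInd a j *
          neInd b d * neInd b j * neInd c j) =
      K * ((M i a * M a b * neInd a c * neInd a j) * ((M * M) c j - M i c - M b c * M b j)
        - M i a * M j a * M a b * M a c) := by
    intro a
    have h := sum_mul_neInd'' (fun d => M c d * M d j) i b a
    rw [← mul_apply, hij] at h
    calc _ = (M i a * M a b * neInd a c * neInd a j * K) *
          ∑ d, M c d * M d j * neInd i d * neInd b d * neInd a d := by
          rw [mul_sum]; exact sum_congr rfl fun d _ => by rw [hK]; ring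
      _ = _ := by
          rw [h, hM.symm c i, hM.symm c b, hM.symm c a, hM.symm a j]
          have k1 := hM.mul_neInd i a
          have k2 := hM.mul_neInd a b
          have k2' : M a b * neInd b a = M a b := by rw [hM.symm a b, hM.mul_neInd]
          have k3 : M j a * neInd a j = M j a := by rw [hM.symm j a, hM.mul_neInd]
          have k4 := hM.mul_neInd a c
          linear_combination (-M i a * M a b * neInd a c * neInd a j * M b c * M b j) * hKb +
            (-K * M a b * M a c * M j a * neInd a c * neInd a j * neInd b a) * k1 +
            (-K * M i a * M a c * M j a * neInd a c * neInd a j) * k2' +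
            (-K * M i a * M a b * M a c * neInd a c) * k3 +
            (-K * M i a * M a b * M j a) * k4
  have h2 : K * ∑ a, M i a * M a b * neInd a c * neInd a j =
      K * ((M * M) i b - M j b - M i c * M b c) := by
    rw [sum_mul_neInd (fun a => M i a * M a b * neInd a c), sum_mul_neInd, ← mul_apply, hij,
      hM.symm c b]
    have k : M j b * neInd j c * K = M j b * K := by
      have : neInd j c = neInd c j := by simp only [neInd, eq_comm]
      rw [this]; linear_combination M j b * hKc
    linear_combination -k
  rw [sum_congr rfl fun a _ => e1 a, ← mul_sum, sum_sub_distrib, ← sum_mul, mul_sub, ← mul_assoc,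
    h2, hK]
  ring

theorem sum_paths_five {i j : V} (hne : i ≠ j) (hij : M i j = 1) :
    ∑ b, ∑ c, ∑ a, ∑ d, M i a * M a b * M b c * M c d * M d j *
        (neInd i b * neInd i c * neInd i d * neInd a c * neInd a d * neInd a j *
          neInd b d * neInd b j * neInd c j) =
      (M * M * M * M * M) i j
      - (M * M * M * M) i i - (M * M * M * M) j j
      - ∑ k, (M * M) i k * (M * M) k k * M j k
      - ∑ k, M i k * (M * M) k k * (M * M) j k
      + ∑ k, M i k * (M * M) k k + ∑ k, M j k * (M * M) k k + 2 * (M * M * M) i j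
      - ∑ k, M i k * M j k * (M * M * M) k k
      - (((M * M) i i - 2) * ((M * M * M) i j - 2 * (M * M) i i))
      - (((M * M) j j - 2) * ((M * M * M) i j - 2 * (M * M) j j))
      + 3 * ∑ k, M i k * M j k * (M * M) i k + 3 * ∑ k, M i k * M j k * (M * M) j k
      - (M * M) i j * ((M * M * M) i i + (M * M * M) j j)
      + 3 * ((M * M) i j * (M * M) i j) - 4 * (M * M) i j
      + ((M * M) i i - 2) * ((M * M) j j - 2) := by
  have hji : M j i = 1 := hM.symm j i ▸ hij
  obtain ⟨B, hB⟩ : ∃ B, B = M * M := ⟨_, rfl⟩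
  have hBs : ∀ x y, B x y = B y x := by rw [hB]; exact hM.mul_self_symm
  have hBa : ∀ x y, B x y = ∑ z, M x z * M y z := fun x y => by
    rw [hB, mul_apply]; exact sum_congr rfl fun z _ => by rw [hM.symm z y]
  have hd : ∀ x, ∑ z, M x z = B x x := by rw [hB]; exact hM.sum_sq
  -- `T b c` counts the coincidences `a = d`: common neighbours of `i`, `j`, `b`, `c`.
  obtain ⟨T, hT⟩ : ∃ T : V → V → ℝ, T = fun b c => ∑ a, M i a * M j a * M a b * M a c := ⟨_, rfl⟩
  have hTs : ∀ b c, T b c = T c b := fun b c => by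
    rw [hT]; exact sum_congr rfl fun a _ => by ring
  have hC : ∀ x y, (M * M * M) x y = ∑ z, B x z * M y z := fun x y => by
    rw [← hB, mul_apply]; exact sum_congr rfl fun z _ => by rw [hM.symm z y]
  have hCs : ∀ x y, ∑ z, M x z * B y z = ∑ z, B x z * M y z := fun x y => by
    rw [← hC, Matrix.mul_assoc, ← hB, mul_apply]
    exact sum_congr rfl fun z _ => by rw [hBs z y]
  have hQ : ∀ x, (M * M * M * M) x x = ∑ b, ∑ c, M b c * B x b * M x c := fun x => by
    rw [mul_apply, sum_comm]
    refine sum_congr rfl fun c _ => ?_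
    rw [hC, sum_mul]
    exact sum_congr rfl fun b _ => by rw [hM.symm c b, hM.symm c x]; ring
  have hA5 : (M * M * M * M * M) i j = ∑ b, ∑ c, M b c * (B i b * B j c) := by
    rw [Matrix.mul_assoc (M * M * M), ← hB, mul_apply, sum_comm]
    refine sum_congr rfl fun c _ => ?_
    rw [mul_apply, sum_mul]
    exact sum_congr rfl fun b _ => by rw [hBs c j]; ring
  let F : V → V → ℝ := fun b c =>
    M b c * ((B i b - M j b - M i c * M b c) * (B j c - M i c - M b c * M j b) - T b c)
  have hF : ∀ b c, ∑ a, ∑ d, M i a * M a b * M b c * M c d * M d j *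
        (neInd i b * neInd i c * neInd i d * neInd a c * neInd a d * neInd a j *
          neInd b d * neInd b j * neInd c j) =
      (F b c * neInd i c * neInd c j) * neInd i b * neInd b j := fun b c => by
    rw [hM.sum_paths_five_inner hij, ← hB, hBs c j, hM.symm b j]
    simp only [F, hT]
    ring
  -- Inclusion–exclusion over `b, c` in `{i, j}`; the corrections `F i i` and `F j j` vanish with
  -- the diagonal of `M`.
  have hsum : ∑ b, ∑ c, (F b c * neInd i c * neInd c j) * neInd i b * neInd b j =
      ∑ b, ∑ c, F b c - ∑ b, F b i - ∑ b, F b j - ∑ c, F i c - ∑ c, F j c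
        + F i j + F j i := by
    have h1 : ∀ b, ∑ c, (F b c * neInd i c * neInd c j) * neInd i b * neInd b j =
        (∑ c, F b c - F b i - F b j) * neInd i b * neInd b j := fun b => by
      rw [← sum_mul, ← sum_mul, sum_mul_neInd_neInd _ hne]
    rw [sum_congr rfl fun b _ => h1 b, sum_mul_neInd_neInd _ hne]
    have z : ∀ x, F x x = 0 := fun x => by simp only [F, hM.diag, zero_mul]
    simp only [sum_sub_distrib, z]
    ring
  rw [sum_congr rfl fun b _ => sum_congr rfl fun c _ => hF b c, hsum]
  have sT : ∑ b, ∑ c, M b c * T b c = ∑ k, M i k * M j k * (M * M * M) k k := by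
    simp only [hT, mul_sum, hC, hBa, sum_mul]
    rw [sum_congr rfl fun b _ => sum_comm, sum_comm]
    refine sum_congr rfl fun a _ => sum_congr rfl fun b _ => sum_congr rfl fun c _ => ?_
    ring
  have sTi : ∀ x, ∑ c, M x c * T x c = ∑ k, M i k * M j k * M x k * B x k := fun x => by
    simp only [hT, mul_sum, hBa]
    rw [sum_comm]
    refine sum_congr rfl fun a _ => sum_congr rfl fun c _ => ?_
    rw [hM.symm x a]; ring
  have sTi' : ∑ c, M i c * T i c = ∑ k, M i k * M j k * B i k := by
    rw [sTi]; exact sum_congr rfl fun k _ => by linear_combination (M j k * B i k) * hM.sq i k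
  have sTj' : ∑ c, M j c * T j c = ∑ k, M i k * M j k * B j k := by
    rw [sTi]; exact sum_congr rfl fun k _ => by linear_combination (M i k * B j k) * hM.sq j k
  have Tij : T i j = B i j := by
    rw [hT, hBa]
    refine sum_congr rfl fun k _ => ?_
    rw [hM.symm k i, hM.symm k j]
    linear_combination (M j k * M j k) * hM.sq i k + M i k * hM.sq j k
  have hdouble : ∑ b, ∑ c, F b c = (M * M * M * M * M) i j
      - (M * M * M * M) i i - (M * M * M * M) j j
      - ∑ k, B i k * B k k * M j k - ∑ k, M i k * B k k * B j k
      + ∑ k, M i k * B k k + ∑ k, M j k * B k k + 2 * (M * M * M) i j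
      - ∑ k, M i k * M j k * (M * M * M) k k := by
    have e : ∀ b c, F b c = M b c * (B i b * B j c) - M b c * B i b * M i c
        - B i b * M b c * M j b - M b c * B j c * M j b + M j b * (M b c * M i c) + M j b * M b c
        - M i c * M c b * B j c + M i c * M c b + M j b * (M b c * M i c) - M b c * T b c := by
      intro b c
      have q := hM.sq b c
      have q1 := hM.sq j b
      have q2 := hM.sq i c
      simp only [F]
      rw [hM.symm c b]
      linear_combination (-M j b * B i b + M j b * M j b - M i c * B j c + M i c * M i c +
        M i c * M j b * (M b c + 1)) * q + M b c * q1 + M b c * q2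
    have f1 : ∑ b, ∑ c, B i b * M b c * M j b = ∑ k, B i k * B k k * M j k :=
      sum_congr rfl fun b _ => by rw [← hd, mul_sum, sum_mul]
    have f2 : ∑ b, ∑ c, M b c * B j c * M j b = (M * M * M * M) j j := by
      rw [hQ, sum_comm]
      exact sum_congr rfl fun b _ => sum_congr rfl fun c _ => by rw [hM.symm b c]
    have f3 : ∑ b, ∑ c, M j b * (M b c * M i c) = (M * M * M) i j := by
      rw [hC]
      refine sum_congr rfl fun b _ => ?_
      rw [← mul_sum, ← hBa, hBs, mul_comm]
    have f4 : ∑ b, ∑ c, M j b * M b c = ∑ k, M j k * B k k :=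
      sum_congr rfl fun b _ => by rw [← hd, mul_sum]
    have f5 : ∑ b, ∑ c, M i c * M c b * B j c = ∑ k, M i k * B k k * B j k := by
      rw [sum_comm]
      exact sum_congr rfl fun b _ => by rw [← hd, mul_sum, sum_mul]
    have f6 : ∑ b, ∑ c, M i c * M c b = ∑ k, M i k * B k k := by
      rw [sum_comm]
      exact sum_congr rfl fun b _ => by rw [← hd, mul_sum]
    simp only [e, sum_sub_distrib, sum_add_distrib]
    rw [← hA5, ← hQ, f1, f2, f3, f4, f5, f6, sT]
    ring
  -- Reversing the path swaps `i` with `j` and `b` with `c` and preserves `F`, so `col_j` and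
  -- `col_i` mirror `row_i` and `row_j`.
  have row_i : ∑ c, F i c = (B i i - 2) * ((M * M * M) i j - 2 * B i i)
      - ∑ k, M i k * M j k * B i k := by
    have e : ∀ c, F i c = (B i i - 2) * (M i c * B j c) - 2 * (B i i - 2) * M i c - M i c * T i c := by
      intro c
      simp only [F]
      rw [hji]
      linear_combination (-2 * (B i i - 1) - B j c + 2 * (M i c + 1) - M i c * B j c + 2 * (M i c * M i c)) * hM.sq i c
    simp only [e, sum_sub_distrib, ← mul_sum]
    rw [sTi', hCs, ← hC, hd]
    ring
  have row_j : ∑ c, F j c = B i j * (M * M * M) j j - B i j * B i j + B i j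
      - 2 * ∑ k, M i k * M j k * B j k := by
    have e : ∀ c, F j c = B i j * (B j c * M j c) - B i j * (M i c * M j c) - M i c * M j c * B j c
        + M i c * M j c - M j c * T j c := by
      intro c
      simp only [F]
      rw [hM.diag]
      linear_combination (-M i c * B j c + M i c * M i c) * hM.sq j c + M j c * hM.sq i c
    simp only [e, sum_sub_distrib, sum_add_distrib, ← mul_sum]
    rw [sTj', ← hC, ← hBa]
    ring
  have col_j : ∑ b, F b j = (B j j - 2) * ((M * M * M) i j - 2 * B j j)
      - ∑ k, M i k * M j k * B j k := by
    have e : ∀ b, F b j = (B j j - 2) * (B i b * M j b) - 2 * (B j j - 2) * M j b - M j b * T j b := by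
      intro b
      simp only [F]
      rw [hij, hTs, hM.symm b j]
      linear_combination (-2 * (B j j - 1) - B i b + 2 * (M j b + 1) - M j b * B i b + 2 * (M j b * M j b)) * hM.sq j b
    simp only [e, sum_sub_distrib, ← mul_sum]
    rw [sTj', ← hC, hd]
    ring
  have col_i : ∑ b, F b i = B i j * (M * M * M) i i - B i j * B i j + B i j
      - 2 * ∑ k, M i k * M j k * B i k := by
    have e : ∀ b, F b i = B i j * (B i b * M i b) - B i j * (M i b * M j b) - M i b * M j b * B i b
        + M i b * M j b - M i b * T i b := by
      intro b
      simp only [F]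
      rw [hM.diag, hTs, hM.symm b i, hBs j i]
      linear_combination (-M j b * B i b + M j b * M j b) * hM.sq i b + M i b * hM.sq j b
    simp only [e, sum_sub_distrib, sum_add_distrib, ← mul_sum]
    rw [sTi', ← hC, ← hBa]
    ring
  have Fij : F i j = (B i i - 2) * (B j j - 2) - B i j := by
    simp only [F, hij, hji, Tij]; ring
  have Fji : F j i = B i j * B i j - B i j := by
    simp only [F, hM.diag, hji, hTs j i, Tij, hBs j i]; ring
  rw [hdouble, row_i, row_j, col_i, col_j, Fij, Fji, ← hB]
  ring

end IsSimpleAdj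
end

/-! ### Entries of the words at adjacent pairs -/

section
variable {V : Type*} [DecidableEq V]

omit [DecidableEq V] in
theorem SimpleGraph.isSimpleAdj_adjMatrix (G : SimpleGraph V) [DecidableRel G.Adj] :
    IsSimpleAdj (G.adjMatrix ℝ) where
  symm x y := by simp [SimpleGraph.adjMatrix_apply, G.adj_comm]
  diag x := by simp
  sq x y := by simp [SimpleGraph.adjMatrix_apply]

end

namespace Matlang
variable {V : Type*} [Fintype V] [DecidableEq V] (M : Matrix V V ℝ)

section
variable {a b c : Dim}

theorem eval_add (e f : Word a b) : (e + f).eval M = e.eval M + f.eval M := rfl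

theorem eval_sub (e f : Word a b) : (e - f).eval M = e.eval M - f.eval M := by
  rw [sub_eq_add_neg, ← neg_one_smul ℝ (f.eval M)]
  rfl

theorem eval_mul (e : Word a b) (f : Word b c) : (e * f).eval M = e.eval M * f.eval M := rfl

theorem eval_smul (r : ℝ) (e : Word a b) : (r • e).eval M = r • e.eval M := rfl

theorem eval_had (e f : Word a b) : (e.had f).eval M = (e.eval M).hadamard (f.eval M) := rfl

end

theorem eval_A : A.eval M = M := rfl

theorem eval_Id : Id.eval M = (1 : Matrix V V ℝ) := rfl

theorem eval_J (i j : V) : J.eval M i j = if i = j then 0 else 1 := by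
  have h : (one * one.tr).eval M i j = (1 : ℝ) := by
    change ∑ _u : PUnit, (1 : ℝ) * 1 = 1
    simp
  rw [J, eval_sub, eval_Id]
  change (one * one.tr).eval M i j - (1 : Matrix V V ℝ) i j = _
  rw [h, one_apply]
  split_ifs <;> simp

theorem eval_A2 : A2.eval M = M * M := rfl
theorem eval_A3 : A3.eval M = M * M * M := rfl
theorem eval_A4 : A4.eval M = M * M * M * M := rfl
theorem eval_A5 : A5.eval M = M * M * M * M * M := rfl

omit [Fintype V] in
theorem hadamard_one (N : Matrix V V ℝ) : N.hadamard 1 = diagonal fun i => N i i := by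
  ext i j
  by_cases h : i = j
  · subst h; simp
  · simp [h]

theorem eval_D2 : D2.eval M = diagonal fun i => (M * M) i i := hadamard_one _
theorem eval_D3 : D3.eval M = diagonal fun i => (M * M * M) i i := hadamard_one _

theorem hadamard_eval_J (N : Matrix V V ℝ) :
    N.hadamard (J.eval M) = N - diagonal fun i => N i i := by
  ext i j
  rw [hadamard_apply, eval_J]
  by_cases h : i = j
  · subst h; simp
  · simp [h]

theorem eval_X2 : X2.eval M = M * M - diagonal fun i => (M * M) i i := hadamard_eval_J M _

theorem eval_X3 : X3.eval M = (M * M * M - diagonal fun i => (M * M * M) i i) -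
    M * (diagonal fun i => (M * M) i i) - (diagonal fun i => (M * M) i i) * M + M := by
  simp only [X3, eval_add, eval_sub, eval_mul, eval_D2, eval_had, eval_A3, hadamard_eval_J, eval_A]

theorem eval_diag_apply {a : Dim} (e : Word a Dim.one) :
    (Word.diag e).eval M = diagonal fun i => e.eval M i PUnit.unit := rfl

theorem eval_mul_one (e : Word Dim.node Dim.node) (i : V) (u : PUnit) :
    (e * one).eval M i u = ∑ j, (e.eval M : Matrix V V ℝ) i j := by
  rw [eval_mul]
  change ∑ j, (e.eval M : Matrix V V ℝ) i j * 1 = _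
  simp

theorem value_cycleSentence (l : ℕ) :
    (cycleSentence l).value M =
      1 / (2 * (l : ℝ)) * ∑ i, ∑ j, M i j * ((X (l - 1)).eval M : Matrix V V ℝ) i j := by
  change 1 / (2 * (l : ℝ)) * ((one.tr * C l * one).eval M : Matrix PUnit PUnit ℝ) _ _ = _
  congr 1
  change ∑ j, (∑ i, (1 : ℝ) * (M i j * ((X (l - 1)).eval M : Matrix V V ℝ) i j)) * 1 = _
  simp only [one_mul, mul_one]
  exact sum_comm

section
variable {M} (hM : IsSimpleAdj M) {i j : V} (hne : i ≠ j) (hij : M i j = 1)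

include hne in
theorem eval_X2_apply : (X2.eval M : Matrix V V ℝ) i j = (M * M) i j := by
  rw [eval_X2]; simp [hne]

include hne hij in
theorem eval_X3_apply : (X3.eval M : Matrix V V ℝ) i j =
    (M * M * M) i j - (M * M) i i - (M * M) j j + 1 := by
  rw [eval_X3]; simp [hne, hij]; ring

-- The `5` of the path count reappears as `2` from `D2 - 2 • Id` plus `3` from `3 • (A2 ⊙ A)`.
include hne hij in
theorem eval_X4_apply : (X4.eval M : Matrix V V ℝ) i j =
    (M * M * M * M) i j - ∑ k, M i k * (M * M) k k * M k j + 5 * (M * M) i j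
        - ((M * M) i i + (M * M) j j) * (M * M) i j - (M * M * M) i i - (M * M * M) j j := by
  have h2 : (2 : ℝ) • (1 : Matrix V V ℝ) = diagonal fun _ => 2 := by
    rw [smul_one_eq_diagonal]
  have h : (M * (diagonal (fun i => (M * M) i i) - (2 : ℝ) • (1 : Matrix V V ℝ)) * M) i j =
      ∑ k, M i k * (M * M) k k * M k j - 2 * (M * M) i j := by
    rw [h2, diagonal_sub, mul_apply, mul_apply (i := i) (k := j), mul_sum, ← sum_sub_distrib]
    refine sum_congr rfl fun k _ => ?_
    rw [mul_diagonal]; ring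
  simp only [X4, eval_add, eval_sub, eval_mul, eval_smul, eval_D2, eval_D3, eval_had, eval_A2,
    eval_A4, hadamard_eval_J, eval_A, eval_Id, eval_X2]
  simp only [Matrix.add_apply, Matrix.sub_apply, Matrix.smul_apply, diagonal_apply_ne _ hne,
    hadamard_apply, mul_diagonal, diagonal_mul, h, hij, smul_eq_mul]
  ring

/-- Entries of `M` are squares, so those of `M * M` are nonnegative and the mark is lost only on
zeros. This handles the one non-polynomial ingredient of `X5`. -/
theorem eval_A2pos_had (hM : IsSimpleAdj M) (x y : V) :
    (M * M) x y * (A2pos.eval M : Matrix V V ℝ) x y = (M * M) x y := by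
  have h0 : 0 ≤ (M * M) x y := by
    rw [mul_apply]
    refine sum_nonneg fun z _ => ?_
    rw [← hM.sq x z, ← hM.sq z y]
    exact mul_nonneg (mul_self_nonneg _) (mul_self_nonneg _)
  change (M * M) x y * (if 0 < (M * M) x y then 1 else 0) = _
  split_ifs with h
  · simp
  · simp [le_antisymm (not_lt.1 h) h0]

-- Evaluates the vector inside `diag` in `X5`: closed walks `x, y, z, k, x` less those with `z = x`
-- or `y = k`, the overlap being the degree of `x`.
include hM in
theorem sum_had_X3 (x : V) : ∑ k, M x k * (X3.eval M : Matrix V V ℝ) x k =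
    (M * M * M * M) x x - (M * M) x x * (M * M) x x - ∑ k, M x k * (M * M) k k + (M * M) x x := by
  have h : ∀ k, M x k * (X3.eval M : Matrix V V ℝ) x k =
      (M * M * M) x k * M k x - (M * M) x x * M x k - M x k * (M * M) k k + M x k := by
    intro k
    rw [hM.symm k x]
    by_cases hk : x = k
    · subst hk; simp [hM.diag]
    · rw [eval_X3]
      simp only [Matrix.add_apply, Matrix.sub_apply, diagonal_apply_ne _ hk, mul_diagonal,
        diagonal_mul]
      linear_combination (-(M * M) x x - (M * M) k k + 1) * hM.sq x k
  rw [sum_congr rfl fun k _ => h k, sum_add_distrib, sum_sub_distrib, sum_sub_distrib, ← mul_sum,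
    hM.sum_sq, ← mul_apply]

include hM hne hij in
theorem eval_X5_apply : (X5.eval M : Matrix V V ℝ) i j =
      (M * M * M * M * M) i j
      - (M * M * M * M) i i - (M * M * M * M) j j
      - ∑ k, (M * M) i k * (M * M) k k * M j k
      - ∑ k, M i k * (M * M) k k * (M * M) j k
      + ∑ k, M i k * (M * M) k k + ∑ k, M j k * (M * M) k k + 2 * (M * M * M) i j
      - ∑ k, M i k * M j k * (M * M * M) k k
      - (((M * M) i i - 2) * ((M * M * M) i j - 2 * (M * M) i i))
      - (((M * M) j j - 2) * ((M * M * M) i j - 2 * (M * M) j j))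
      + 3 * ∑ k, M i k * M j k * (M * M) i k + 3 * ∑ k, M i k * M j k * (M * M) j k
      - (M * M) i j * ((M * M * M) i i + (M * M * M) j j)
      + 3 * ((M * M) i j * (M * M) i j) - 4 * (M * M) i j
      + ((M * M) i i - 2) * ((M * M) j j - 2) := by
  obtain ⟨B, hB⟩ : ∃ B, B = M * M := ⟨_, rfl⟩
  have hBs : ∀ x y, B x y = B y x := by rw [hB]; exact hM.mul_self_symm
  -- Keeping `D` opaque leaves `D - 1` in the form that `g1` and `g2` rewrite.
  obtain ⟨D, hD⟩ : ∃ D : Matrix V V ℝ, D = diagonal fun i => (M * M) i i := ⟨_, rfl⟩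
  have hDI : D - 1 = diagonal fun i => (M * M) i i - 1 := by
    rw [hD, ← diagonal_one, diagonal_sub]
  have g1 : (M * (D - 1) * (X2.eval M : Matrix V V ℝ)) i j =
      ∑ k, M i k * B k k * B j k - (M * M * M) i j - (B j j - 1) * B j j := by
    rw [hDI, eval_X2, Matrix.mul_sub, Matrix.sub_apply, mul_diagonal, mul_diagonal, hij, one_mul,
      mul_apply, Matrix.mul_assoc M M M, mul_apply (M := M) (N := M * M), ← sum_sub_distrib, ← hB]
    congr 1
    exact sum_congr rfl fun k _ => by rw [mul_diagonal, hBs k j]; ring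
  have g2 : ((X2.eval M : Matrix V V ℝ) * (D - 1) * M) i j =
      ∑ k, B i k * B k k * M j k - (M * M * M) i j - (B i i - 1) * B i i := by
    rw [hDI, eval_X2, Matrix.mul_assoc, Matrix.sub_mul, Matrix.sub_apply, diagonal_mul,
      diagonal_mul, hij, mul_one, mul_apply, mul_apply (M := M * M) (N := M), ← sum_sub_distrib,
      ← hB, mul_comm (B i i)]
    congr 1
    exact sum_congr rfl fun k _ => by rw [diagonal_mul, hM.symm k j]; ring
  have g3 : (M * (diagonal fun i => (M * M * M) i i) * M) i j =
      ∑ k, M i k * M j k * (M * M * M) k k := by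
    rw [mul_apply]
    exact sum_congr rfl fun k _ => by rw [mul_diagonal, hM.symm k j]; ring
  have g4 : (M * M.hadamard (M * M)) i j = ∑ k, M i k * M j k * B j k := by
    rw [mul_apply]
    exact sum_congr rfl fun k _ => by rw [hadamard_apply, ← hB, hM.symm k j, hBs k j]; ring
  have g5 : (M.hadamard (M * M) * M) i j = ∑ k, M i k * M j k * B i k := by
    rw [mul_apply]
    exact sum_congr rfl fun k _ => by rw [hadamard_apply, ← hB, hM.symm k j]; ring
  have g6 := eval_A2pos_had hM i j
  have g7 : ∀ x, ((Word.had A X3 * one).eval M : Matrix V PUnit ℝ) x PUnit.unit =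
      (M * M * M * M) x x - (M * M) x x * (M * M) x x - ∑ k, M x k * (M * M) k k + (M * M) x x :=
    fun x => (eval_mul_one M _ x _).trans (sum_had_X3 hM x)
  have g8 := eval_X3_apply hne hij
  simp only [X5, eval_add, eval_sub, eval_mul, eval_smul, eval_D2, eval_D3, eval_had, eval_A2,
    eval_A5, hadamard_eval_J, eval_A, eval_Id, eval_diag_apply]
  simp only [eval_mul, eval_had, eval_A] at g7
  rw [← hD]
  simp only [Matrix.add_apply, Matrix.sub_apply, Matrix.smul_apply, diagonal_apply_ne _ hne,
    hadamard_apply, g1, g2, g3, g4, g5]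
  rw [hDI, hD]
  simp only [diagonal_mul_diagonal, mul_diagonal, diagonal_mul, g7, hij, g8, smul_eq_mul]
  rw [eval_X2]
  simp only [Matrix.sub_apply, diagonal_apply_ne _ hne]
  rw [← hB] at *
  -- By `g6` the `A2pos` term contributes `-3 * B i j`; all else is polynomial.
  linear_combination -3 * g6

end

end Matlang

/-! ### Closed injective sequences as paths closed by an edge -/

section
variable {V : Type*} [Fintype V] [DecidableEq V]

theorem ite_and_eq_mul (p q : Prop) [Decidable p] [Decidable q] :
    (if p ∧ q then (1 : ℝ) else 0) = (if p then 1 else 0) * (if q then 1 else 0) := by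
  split_ifs <;> simp_all

omit [Fintype V] in
theorem ite_ne_eq_neInd (x y : V) : (if ¬ x = y then (1 : ℝ) else 0) = neInd x y := by
  unfold neInd; split_ifs <;> simp_all

/-- Functions on `Fin 3` as triples, endpoints first. -/
def finThreeArrow (V : Type*) : V × V × V ≃ (Fin 3 → V) where
  toFun p := ![p.1, p.2.2, p.2.1]
  invFun f := (f 0, f 2, f 1)
  left_inv _ := rfl
  right_inv f := by ext i; fin_cases i <;> rfl

/-- Functions on `Fin 4` as tuples, in the order `0, 3, 2, 1`. -/
def finFourArrow (V : Type*) : V × V × V × V ≃ (Fin 4 → V) where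
  toFun p := ![p.1, p.2.2.2, p.2.2.1, p.2.1]
  invFun f := (f 0, f 3, f 2, f 1)
  left_inv _ := rfl
  right_inv f := by ext i; fin_cases i <;> rfl

/-- Functions on `Fin 5` as tuples, in the order `0, 4, 2, 1, 3`. -/
def finFiveArrow (V : Type*) : V × V × V × V × V ≃ (Fin 5 → V) where
  toFun p := ![p.1, p.2.2.2.1, p.2.2.1, p.2.2.2.2, p.2.1]
  invFun f := (f 0, f 4, f 2, f 1, f 3)
  left_inv _ := rfl
  right_inv f := by ext i; fin_cases i <;> rfl

/-- Functions on `Fin 6` as tuples, in the order `0, 5, 2, 3, 1, 4`. -/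
def finSixArrow (V : Type*) : V × V × V × V × V × V ≃ (Fin 6 → V) where
  toFun p := ![p.1, p.2.2.2.2.1, p.2.2.1, p.2.2.2.1, p.2.2.2.2.2, p.2.1]
  invFun f := (f 0, f 5, f 2, f 3, f 1, f 4)
  left_inv _ := rfl
  right_inv f := by ext i; fin_cases i <;> rfl

variable (G : SimpleGraph V) [DecidableRel G.Adj]

/-- The endpoints `i`, `j` are the values at `0` and `5`, so the closing edge becomes the outer
factor; the interior is ordered as in `sum_paths_five`. The shorter cycles go the same way. -/
theorem sum_cycles_six :
    (∑ f : Fin 6 → V, if (∀ a, G.Adj (f a) (f (a + 1))) ∧ Function.Injective f then (1 : ℝ) else 0)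
      = ∑ i, ∑ j, G.adjMatrix ℝ i j * ∑ b, ∑ c, ∑ a, ∑ d,
        G.adjMatrix ℝ i a * G.adjMatrix ℝ a b * G.adjMatrix ℝ b c * G.adjMatrix ℝ c d *
          G.adjMatrix ℝ d j *
        (neInd i b * neInd i c * neInd i d * neInd a c * neInd a d * neInd a j *
          neInd b d * neInd b j * neInd c j) := by
  rw [← (finSixArrow V).sum_comp]
  simp only [Fintype.sum_prod_type, mul_sum]
  refine sum_congr rfl fun i _ => sum_congr rfl fun j _ => sum_congr rfl fun b _ =>
    sum_congr rfl fun c _ => sum_congr rfl fun a _ => sum_congr rfl fun d _ => ?_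
  have h : ((∀ k, G.Adj (finSixArrow V (i, j, b, c, a, d) k)
        (finSixArrow V (i, j, b, c, a, d) (k + 1))) ∧
        Function.Injective (finSixArrow V (i, j, b, c, a, d))) ↔
      G.Adj i j ∧ G.Adj i a ∧ G.Adj a b ∧ G.Adj b c ∧ G.Adj c d ∧ G.Adj d j ∧
      ¬ i = b ∧ ¬ i = c ∧ ¬ i = d ∧ ¬ a = c ∧ ¬ a = d ∧ ¬ a = j ∧ ¬ b = d ∧ ¬ b = j ∧ ¬ c = j := by
    constructor
    · rintro ⟨h, h'⟩
      exact ⟨(h 5).symm, h 0, h 1, h 2, h 3, h 4, h'.ne (a₁ := 0) (a₂ := 2) (by decide),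
        h'.ne (a₁ := 0) (a₂ := 3) (by decide), h'.ne (a₁ := 0) (a₂ := 4) (by decide),
        h'.ne (a₁ := 1) (a₂ := 3) (by decide), h'.ne (a₁ := 1) (a₂ := 4) (by decide),
        h'.ne (a₁ := 1) (a₂ := 5) (by decide), h'.ne (a₁ := 2) (a₂ := 4) (by decide),
        h'.ne (a₁ := 2) (a₂ := 5) (by decide), h'.ne (a₁ := 3) (a₂ := 5) (by decide)⟩
    · rintro ⟨h0, h1, h2, h3, h4, h5, n1, n2, n3, n4, n5, n6, n7, n8, n9⟩
      -- Of the fifteen pairs nine are distinct by assumption; the six edges supply the rest.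
      have m0 := h0.ne
      have m1 := h1.ne
      have m2 := h2.ne
      have m3 := h3.ne
      have m4 := h4.ne
      have m5 := h5.ne
      refine ⟨fun k => ?_, ?_⟩
      · fin_cases k
        exacts [h1, h2, h3, h4, h5, h0.symm]
      · have : (List.ofFn (finSixArrow V (i, j, b, c, a, d))).Nodup := by
          change [i, a, b, c, d, j].Nodup
          simp [*]
        exact List.nodup_ofFn.1 this
  rw [if_congr h rfl rfl]
  simp only [ite_and_eq_mul, ite_ne_eq_neInd, SimpleGraph.adjMatrix_apply]
  ring

theorem sum_cycles_five :
    (∑ f : Fin 5 → V, if (∀ a, G.Adj (f a) (f (a + 1))) ∧ Function.Injective f then (1 : ℝ) else 0)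
      = ∑ i, ∑ j, G.adjMatrix ℝ i j * ∑ b, ∑ a, ∑ c,
        G.adjMatrix ℝ i a * G.adjMatrix ℝ a b * G.adjMatrix ℝ b c * G.adjMatrix ℝ c j *
        (neInd i b * neInd i c * neInd a c * neInd a j * neInd b j) := by
  rw [← (finFiveArrow V).sum_comp]
  simp only [Fintype.sum_prod_type, mul_sum]
  refine sum_congr rfl fun i _ => sum_congr rfl fun j _ => sum_congr rfl fun b _ =>
    sum_congr rfl fun a _ => sum_congr rfl fun c _ => ?_
  have h : ((∀ k, G.Adj (finFiveArrow V (i, j, b, a, c) k)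
        (finFiveArrow V (i, j, b, a, c) (k + 1))) ∧
        Function.Injective (finFiveArrow V (i, j, b, a, c))) ↔
      G.Adj i j ∧ G.Adj i a ∧ G.Adj a b ∧ G.Adj b c ∧ G.Adj c j ∧
      ¬ i = b ∧ ¬ i = c ∧ ¬ a = c ∧ ¬ a = j ∧ ¬ b = j := by
    constructor
    · rintro ⟨h, h'⟩
      exact ⟨(h 4).symm, h 0, h 1, h 2, h 3, h'.ne (a₁ := 0) (a₂ := 2) (by decide),
        h'.ne (a₁ := 0) (a₂ := 3) (by decide), h'.ne (a₁ := 1) (a₂ := 3) (by decide),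
        h'.ne (a₁ := 1) (a₂ := 4) (by decide), h'.ne (a₁ := 2) (a₂ := 4) (by decide)⟩
    · rintro ⟨h0, h1, h2, h3, h4, n1, n2, n3, n4, n5⟩
      have m0 := h0.ne
      have m1 := h1.ne
      have m2 := h2.ne
      have m3 := h3.ne
      have m4 := h4.ne
      refine ⟨fun k => ?_, ?_⟩
      · fin_cases k
        exacts [h1, h2, h3, h4, h0.symm]
      · have : (List.ofFn (finFiveArrow V (i, j, b, a, c))).Nodup := by
          change [i, a, b, c, j].Nodup
          simp [*]
        exact List.nodup_ofFn.1 this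
  rw [if_congr h rfl rfl]
  simp only [ite_and_eq_mul, ite_ne_eq_neInd, SimpleGraph.adjMatrix_apply]
  ring

theorem sum_cycles_four :
    (∑ f : Fin 4 → V, if (∀ a, G.Adj (f a) (f (a + 1))) ∧ Function.Injective f then (1 : ℝ) else 0)
      = ∑ i, ∑ j, G.adjMatrix ℝ i j * ∑ b, ∑ a,
        G.adjMatrix ℝ i a * G.adjMatrix ℝ a b * G.adjMatrix ℝ b j * (neInd i b * neInd a j) := by
  rw [← (finFourArrow V).sum_comp]
  simp only [Fintype.sum_prod_type, mul_sum]
  refine sum_congr rfl fun i _ => sum_congr rfl fun j _ => sum_congr rfl fun b _ =>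
    sum_congr rfl fun a _ => ?_
  have h : ((∀ k, G.Adj (finFourArrow V (i, j, b, a) k)
        (finFourArrow V (i, j, b, a) (k + 1))) ∧
        Function.Injective (finFourArrow V (i, j, b, a))) ↔
      G.Adj i j ∧ G.Adj i a ∧ G.Adj a b ∧ G.Adj b j ∧ ¬ i = b ∧ ¬ a = j := by
    constructor
    · rintro ⟨h, h'⟩
      exact ⟨(h 3).symm, h 0, h 1, h 2, h'.ne (a₁ := 0) (a₂ := 2) (by decide),
        h'.ne (a₁ := 1) (a₂ := 3) (by decide)⟩
    · rintro ⟨h0, h1, h2, h3, n1, n2⟩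
      have m0 := h0.ne
      have m1 := h1.ne
      have m2 := h2.ne
      have m3 := h3.ne
      refine ⟨fun k => ?_, ?_⟩
      · fin_cases k
        exacts [h1, h2, h3, h0.symm]
      · have : (List.ofFn (finFourArrow V (i, j, b, a))).Nodup := by
          change [i, a, b, j].Nodup
          simp [*]
        exact List.nodup_ofFn.1 this
  rw [if_congr h rfl rfl]
  simp only [ite_and_eq_mul, ite_ne_eq_neInd, SimpleGraph.adjMatrix_apply]
  ring

theorem sum_cycles_three :
    (∑ f : Fin 3 → V, if (∀ a, G.Adj (f a) (f (a + 1))) ∧ Function.Injective f then (1 : ℝ) else 0)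
      = ∑ i, ∑ j, G.adjMatrix ℝ i j * ∑ a, G.adjMatrix ℝ i a * G.adjMatrix ℝ a j := by
  rw [← (finThreeArrow V).sum_comp]
  simp only [Fintype.sum_prod_type, mul_sum]
  refine sum_congr rfl fun i _ => sum_congr rfl fun j _ => sum_congr rfl fun a _ => ?_
  have h : ((∀ k, G.Adj (finThreeArrow V (i, j, a) k) (finThreeArrow V (i, j, a) (k + 1))) ∧
        Function.Injective (finThreeArrow V (i, j, a))) ↔ G.Adj i j ∧ G.Adj i a ∧ G.Adj a j := by
    constructor
    · rintro ⟨h, -⟩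
      exact ⟨(h 2).symm, h 0, h 1⟩
    · rintro ⟨h0, h1, h2⟩
      have m0 := h0.ne
      have m1 := h1.ne
      have m2 := h2.ne
      refine ⟨fun k => ?_, ?_⟩
      · fin_cases k
        exacts [h1, h2, h0.symm]
      · have : (List.ofFn (finThreeArrow V (i, j, a))).Nodup := by
          change [i, a, j].Nodup
          simp [*]
        exact List.nodup_ofFn.1 this
  rw [if_congr h rfl rfl]
  simp only [ite_and_eq_mul, SimpleGraph.adjMatrix_apply]

end

/-- On every finite simple graph and for `3 ≤ l ≤ 6`, the MATLANG sentence `(1 / (2l)) 1ᵀ C_l 1`,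
applied to the adjacency matrix, computes the number of `l`-cycles of the graph, that is, the
number of its subgraphs isomorphic to the cycle graph on `l` vertices. -/
theorem mainTheorem11 {V : Type*} [Fintype V] [DecidableEq V] (G : SimpleGraph V)
    [DecidableRel G.Adj] (l : ℕ) (hl : 3 ≤ l) (hl' : l ≤ 6) :
    (Matlang.cycleSentence l).value (G.adjMatrix ℝ) =
      (G.copyCount (SimpleGraph.cycleGraph l) : ℝ) := by
  obtain ⟨n, rfl⟩ := Nat.exists_eq_add_of_le' hl
  have hM := G.isSimpleAdj_adjMatrix
  -- The factor `G.adjMatrix ℝ i j` kills non-adjacent pairs, where the words need not count paths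
  -- for this argument.
  have hadj : ∀ P : V → V → ℝ, (∀ i j, i ≠ j → G.adjMatrix ℝ i j = 1 →
      ((Matlang.X (n + 2)).eval (G.adjMatrix ℝ) : Matrix V V ℝ) i j = P i j) →
      ∑ i, ∑ j, G.adjMatrix ℝ i j * ((Matlang.X (n + 2)).eval (G.adjMatrix ℝ) : Matrix V V ℝ) i j =
        ∑ i, ∑ j, G.adjMatrix ℝ i j * P i j := fun P hP => by
    refine sum_congr rfl fun i _ => sum_congr rfl fun j _ => ?_
    by_cases h : G.Adj i j
    · rw [hP i j h.ne (by simp [h])]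
    · simp [h]
  have key : ∑ i, ∑ j, G.adjMatrix ℝ i j *
      ((Matlang.X (n + 2)).eval (G.adjMatrix ℝ) : Matrix V V ℝ) i j =
      ∑ f : Fin (n + 3) → V,
        if (∀ a, G.Adj (f a) (f (a + 1))) ∧ Function.Injective f then (1 : ℝ) else 0 := by
    obtain rfl | rfl | rfl | rfl : n = 0 ∨ n = 1 ∨ n = 2 ∨ n = 3 := by lia
    · rw [sum_cycles_three]
      exact hadj _ fun i j hne hij => Matlang.eval_X2_apply hne
    · rw [sum_cycles_four]
      exact hadj _ fun i j hne hij =>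
        (Matlang.eval_X3_apply hne hij).trans (hM.sum_paths_three hij).symm
    · rw [sum_cycles_five]
      exact hadj _ fun i j hne hij =>
        (Matlang.eval_X4_apply hne hij).trans (hM.sum_paths_four hne hij).symm
    · rw [sum_cycles_six]
      exact hadj _ fun i j hne hij =>
        (Matlang.eval_X5_apply hM hne hij).trans (hM.sum_paths_five hne hij).symm
  rw [Matlang.value_cycleSentence, show n + 3 - 1 = n + 2 by lia, key,
    ← G.two_mul_mul_copyCount_cycleGraph n]
  push_cast
  field_simp
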